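/- Let $\mathcal A$ be a bounded convex subset of a real locally convex space $E$ such that the relative topology of $\mathcal A$ is defined by countably many continuous seminorms on $E$ which separate the points of $\mathcal A$, and such that $\mathcal A$ is separable and is complete in the metric generated by these seminorms. Let $C(\mathcal A)$ be the set of continuous bounded functions $\mathcal A\to\mathbb R$ and $M(\mathcal A)$ the set of Borel probability measures on $\mathcal A$ with the topology of weak convergence. The barycenter of $\mu\in M(\mathcal A)$ is the point $\mathbf b(\mu)\in\mathcal A$ with $\varphi(\mathbf b(\mu))=\int_{\mathcal A}\varphi\,d\mu$ for every continuous linear functional $\varphi$ on $E$; for $x\in\mathcal A$ put $M_x(\mathcal A)=\{\mu\in M(\mathcal A):\mathbf b(\mu)=x\}$. The set $\mathcal A$ is called $\mu$-compact if $\mathbf b^{-1}(K)$ is compact for every compact $K\subseteq\mathcal A$, and pointwise $\mu$-compact if $M_x(\mathcal A)$ is compact for every $x\in\mathcal A$. For $f\in C(\mathcal A)$ let $\mathrm{co}\,f$ be the greatest convex function on $\mathcal A$ majorized by $f$, and let $\overline{\mathrm{co}}\,f$ be the greatest convex lower semicontinuous function on $\mathcal A$ majorized by $f$. Then: 1. $\mathcal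 A$ is pointwise $\mu$-compact if and only if for every increasing (that is, $f_n\le f_{n+1}$ for all $n$) sequence $\{f_n\}\subset C(\mathcal A)$ converging pointwise to a function $f_0\in C(\mathcal A)$, the sequence $\{\mathrm{co}\,f_n\}$ converges pointwise to $\mathrm{co}\,f_0$. 2. $\mathcal A$ is $\mu$-compact if and only if $\mathcal A$ is pointwise $\mu$-compact and $\mathrm{co}\,f=\overline{\mathrm{co}}\,f$ for every $f\in C(\mathcal A)$. -/

import Mathlib

open Set Filter Topology MeasureTheory
open scoped BoundedContinuousFunction

section MuCompact

variable {E : Type*} [AddCommGroup E] [Module ℝ E] [TopologicalSpace E]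

/-- The sequence `q` of continuous seminorms on `E` defines the (relative) topology of `A`, it
separates the points of `A`, and `A` is complete in the metric generated by `q`, for instance
`d x y = ∑ n, 2⁻ⁿ * min 1 (q n (x - y))`. -/
structure IsCompleteMetrizing (q : ℕ → Seminorm ℝ E) (A : Set E) : Prop where
  /-- Every member of the sequence is continuous for the topology of `E`. -/
  continuous : ∀ n, Continuous (q n)
  /-- The generated pseudometric is a metric on `A`. -/
  separating : ∀ x ∈ A, ∀ y ∈ A, (∀ n, q n (x - y) = 0) → x = y
  /-- Every relative neighbourhood of a point of `A` contains a relative ball of finitely many of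
  the seminorms. (The converse is the continuity of the seminorms.) -/
  nhds_basis : ∀ x ∈ A, ∀ U ∈ 𝓝 x, ∃ (n : ℕ) (r : ℝ), 0 < r ∧
    ∀ y ∈ A, (∀ i < n, q i (y - x) < r) → y ∈ U
  /-- A sequence in `A` that is Cauchy for each of the seminorms converges to a point of `A`. -/
  complete : ∀ u : ℕ → E, (∀ n, u n ∈ A) →
    (∀ i, ∀ ε : ℝ, 0 < ε → ∃ N, ∀ m ≥ N, ∀ n ≥ N, q i (u m - u n) < ε) →
    ∃ x ∈ A, Tendsto u atTop (𝓝 x)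

/-- `A` is a bounded convex complete separable metrizable subset of `E`: its topology is defined by
countably many continuous seminorms on `E`, and it is separable, and complete in the metric
generated by these seminorms. -/
structure IsBoundedConvexPolish (A : Set E) : Prop where
  bounded : Bornology.IsVonNBounded ℝ A
  convex : Convex ℝ A
  separable : TopologicalSpace.SeparableSpace A
  metrizable : ∃ q : ℕ → Seminorm ℝ E, IsCompleteMetrizing q A

/-- `x` is the barycenter of `μ`: the weak (Pettis) integral of the inclusion `A → E` with respect
to `μ` is `x`. -/
def IsBarycenter [MeasurableSpace E] {A : Set E} (μ : ProbabilityMeasure A) (x : A) : Prop :=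
  ∀ φ : E →L[ℝ] ℝ, Integrable (fun a : A => φ a) (μ : Measure A) ∧
    ∫ a : A, φ a ∂(μ : Measure A) = φ x

/-- `A` is μ-compact: the preimage of every compact subset of `A` under the barycenter map is
compact in the topology of weak convergence. -/
def IsMuCompact [MeasurableSpace E] [BorelSpace E] (A : Set E) : Prop :=
  ∀ K : Set A, IsCompact K → IsCompact {μ : ProbabilityMeasure A | ∃ x ∈ K, IsBarycenter μ x}

/-- `A` is pointwise μ-compact: for each `x ∈ A`, the set of all Borel probability measures on `A`
with barycenter `x` is compact in the topology of weak convergence. -/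
def IsPointwiseMuCompact [MeasurableSpace E] [BorelSpace E] (A : Set E) : Prop :=
  ∀ x : A, IsCompact {μ : ProbabilityMeasure A | IsBarycenter μ x}

/-- The convex hull `co f` of a bounded function `f` on `A`: the pointwise supremum of all convex
functions on `A` majorized by `f`, see `isGreatest_coHull`. -/
noncomputable def coHull {A : Set E} (f : A → ℝ) (x : A) : ℝ :=
  sSup {r : ℝ | ∃ g : E → ℝ, ConvexOn ℝ A g ∧ (∀ a : A, g a ≤ f a) ∧ g x = r}

/-- The convex closure of a bounded function `f` on `A`: the pointwise supremum of all convex lower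
semicontinuous functions on `A` majorized by `f`, see `isGreatest_coClosure`. -/
noncomputable def coClosure {A : Set E} (f : A → ℝ) (x : A) : ℝ :=
  sSup {r : ℝ | ∃ g : E → ℝ, ConvexOn ℝ A g ∧ LowerSemicontinuousOn g A ∧
    (∀ a : A, g a ≤ f a) ∧ g x = r}

/-- `co f` is the greatest convex function on `A` majorized by `f`. -/
theorem isGreatest_coHull {A : Set E} (hA : Convex ℝ A) (f : A →ᵇ ℝ) :
    IsGreatest {h : A → ℝ | (∃ g : E → ℝ, ConvexOn ℝ A g ∧ ∀ a : A, g a = h a) ∧ h ≤ f}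
      (coHull f) := by
  classical
  have hbd : ∀ x : A, BddAbove
      {r : ℝ | ∃ g : E → ℝ, ConvexOn ℝ A g ∧ (∀ a : A, g a ≤ f a) ∧ g x = r} := by
    rintro x
    refine ⟨f x, ?_⟩
    rintro r ⟨g, -, hg, rfl⟩
    exact hg x
  have hne : ∀ x : A,
      {r : ℝ | ∃ g : E → ℝ, ConvexOn ℝ A g ∧ (∀ a : A, g a ≤ f a) ∧ g x = r}.Nonempty :=
    fun x => ⟨-‖f‖, fun _ => -‖f‖, convexOn_const _ hA, fun a => f.neg_norm_le_apply a, rfl⟩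
  refine ⟨⟨⟨fun x => if hx : x ∈ A then coHull f ⟨x, hx⟩ else 0, ⟨hA, ?_⟩, fun a => by simp⟩, ?_⟩,
    ?_⟩
  · intro x hx y hy a b ha hb hab
    have hz := hA hx hy ha hb hab
    simp only [hx, hy, hz, dite_true]
    refine csSup_le (hne _) ?_
    rintro r ⟨g, hg, hgf, rfl⟩
    refine (hg.2 hx hy ha hb hab).trans ?_
    have h1 : g x ≤ coHull f ⟨x, hx⟩ := le_csSup (hbd _) ⟨g, hg, hgf, rfl⟩
    have h2 : g y ≤ coHull f ⟨y, hy⟩ := le_csSup (hbd _) ⟨g, hg, hgf, rfl⟩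
    simp only [smul_eq_mul]
    gcongr
  · intro x
    refine csSup_le (hne x) ?_
    rintro r ⟨g, -, hg, rfl⟩
    exact hg x
  · rintro h ⟨⟨g, hg, hgh⟩, hf⟩ x
    exact le_csSup (hbd x) ⟨g, hg, fun a => (hgh a).trans_le (hf a), hgh x⟩

/-- The convex closure of `f` is the greatest convex lower semicontinuous function on `A` majorized
by `f`. -/
theorem isGreatest_coClosure {A : Set E} (hA : Convex ℝ A) (f : A →ᵇ ℝ) :
    IsGreatest {h : A → ℝ | (∃ g : E → ℝ, ConvexOn ℝ A g ∧ LowerSemicontinuousOn g A ∧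
      ∀ a : A, g a = h a) ∧ h ≤ f} (coClosure f) := by
  classical
  have hbd : ∀ x : A, BddAbove {r : ℝ | ∃ g : E → ℝ, ConvexOn ℝ A g ∧
      LowerSemicontinuousOn g A ∧ (∀ a : A, g a ≤ f a) ∧ g x = r} := by
    rintro x
    refine ⟨f x, ?_⟩
    rintro r ⟨g, -, -, hg, rfl⟩
    exact hg x
  have hne : ∀ x : A, {r : ℝ | ∃ g : E → ℝ, ConvexOn ℝ A g ∧
      LowerSemicontinuousOn g A ∧ (∀ a : A, g a ≤ f a) ∧ g x = r}.Nonempty :=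
    fun x => ⟨-‖f‖, fun _ => -‖f‖, convexOn_const _ hA, lowerSemicontinuousOn_const,
      fun a => f.neg_norm_le_apply a, rfl⟩
  refine ⟨⟨⟨fun x => if hx : x ∈ A then coClosure f ⟨x, hx⟩ else 0, ⟨hA, ?_⟩, ?_,
    fun a => by simp⟩, ?_⟩, ?_⟩
  · intro x hx y hy a b ha hb hab
    have hz := hA hx hy ha hb hab
    simp only [hx, hy, hz, dite_true]
    refine csSup_le (hne _) ?_
    rintro r ⟨g, hg, hgl, hgf, rfl⟩
    refine (hg.2 hx hy ha hb hab).trans ?_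
    have h1 : g x ≤ coClosure f ⟨x, hx⟩ := le_csSup (hbd _) ⟨g, hg, hgl, hgf, rfl⟩
    have h2 : g y ≤ coClosure f ⟨y, hy⟩ := le_csSup (hbd _) ⟨g, hg, hgl, hgf, rfl⟩
    simp only [smul_eq_mul]
    gcongr
  · intro x hx c hc
    simp only [hx, dite_true] at hc
    obtain ⟨r, ⟨g, hg, hgl, hgf, rfl⟩, hr⟩ := exists_lt_of_lt_csSup (hne ⟨x, hx⟩) hc
    filter_upwards [hgl x hx c hr, self_mem_nhdsWithin] with y hy hyA
    simp only [hyA, dite_true]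
    exact hy.trans_le (le_csSup (hbd ⟨y, hyA⟩) ⟨g, hg, hgl, hgf, rfl⟩)
  · intro x
    refine csSup_le (hne x) ?_
    rintro r ⟨g, -, -, hg, rfl⟩
    exact hg x
  · rintro h ⟨⟨g, hg, hgl, hgh⟩, hf⟩ x
    exact le_csSup (hbd x) ⟨g, hg, hgl, fun a => (hgh a).trans_le (hf a), hgh x⟩

end MuCompact

/-!
Everything rests on one formula: for `f` continuous and bounded, `coHull f x` is the infimum of
`∫ f dμ` over *all* probability measures `μ` with barycenter `x` (`isGLB_coHull`). The infimum is a
convex function below `f`, so it is at most `coHull f`. The other inequality,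
`ConvexOn.le_integral_of_isBoundedConvexPolish`, is Jensen's inequality for a convex function `g`
that need not be semicontinuous but lies below a continuous `f`. Divide `A` into finitely many
pieces contained in small balls and a remainder of small mass; boundedness, convexity and
completeness give every piece a barycenter (`IsBoundedConvexPolish.exists_barycenter`), which by
Hahn–Banach stays in the ball, where `f` is almost constant. The barycenter of `μ` is a finite
convex combination of these points, and finite convexity of `g` suffices.

If the measures with barycenter `x` form a compact set and `fₙ` increases to `f₀`, Dini's argument
for the continuous functions `μ ↦ ∫ fₙ dμ` shows that the infima converge
(`IsPointwiseMuCompact.tendsto_coHull`). If preimages of all compact sets are compact, nearly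
optimal measures for points `uₙ → x` have a cluster point with barycenter `x`, so `coHull f` is lower
semicontinuous and hence equal to `coClosure f` (`IsMuCompact.lowerSemicontinuous_coHull`).

For the converses, the preimage of a compact set `K` under the barycenter map is closed, so by
Prokhorov's theorem it is enough to show that it is tight. Tightness is tested on functions `fₙ`
that increase to `1` and are supported near finite sets
(`isTightMeasureSet_of_forall_integral_ge`): as `coHull fₙ x ≤ ∫ fₙ dμ`, uniform convergence of
`coHull fₙ` to `1` on `K` is enough. For a single point this is the assumed convergence; for
general `K` it follows from pointwise convergence by Dini's theorem, since `coHull fₙ = coClosure fₙ`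
is lower semicontinuous.
-/

/-! ### Metrizability and continuous functionals -/

section Metrization

variable {E : Type*} [AddCommGroup E] [Module ℝ E] [TopologicalSpace E]

/-- The complete metric comes from the uniformity generated on `A` by the seminorms. It need not be
the one that `A` inherits from `E`, which only has the same topology. -/
theorem IsCompleteMetrizing.isCompletelyMetrizableSpace [IsTopologicalAddGroup E]
    {q : ℕ → Seminorm ℝ E} {A : Set E} (hq : IsCompleteMetrizing q A) :
    TopologicalSpace.IsCompletelyMetrizableSpace A := by
  let d : ℕ → PseudoMetricSpace A := fun n =>
    { dist := fun x y => q n ((x : E) - y)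
      dist_self := fun x => by simp
      dist_comm := fun x y => map_sub_rev (q n) _ _
      dist_triangle := fun x y z => by
        simpa using map_add_le_add (q n) ((x : E) - y) ((y : E) - z) }
  let u : ℕ → UniformSpace A := fun n => (d n).toUniformSpace
  have hbasis : ∀ n, (@uniformity A (u n)).HasBasis (fun ε : ℝ => 0 < ε)
      fun ε => {p : A × A | q n ((p.1 : E) - p.2) < ε} := fun n =>
    @Metric.uniformity_basis_dist A (d n)
  have hball : ∀ n (x : A), (@nhds A (u n).toTopologicalSpace x).HasBasis (fun ε : ℝ => 0 < ε)
      fun ε => {y : A | q n ((y : E) - x) < ε} := fun n x =>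
    @Metric.nhds_basis_ball A (d n) x
  have htop : (⨅ n, u n).toTopologicalSpace = (inferInstance : TopologicalSpace A) := by
    refine TopologicalSpace.ext_nhds fun x => ?_
    rw [UniformSpace.toTopologicalSpace_iInf, nhds_iInf]
    refine le_antisymm ?_ ?_
    · intro s hs
      rw [nhds_subtype_eq_comap, mem_comap] at hs
      obtain ⟨t, ht, hts⟩ := hs
      obtain ⟨n, r, hr, h⟩ := hq.nhds_basis x x.2 t ht
      have : (⋂ i ∈ Finset.range n, {y : A | q i ((y : E) - x) < r}) ∈
          ⨅ i, @nhds A (u i).toTopologicalSpace x :=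
        (Filter.biInter_finset_mem _).2 fun i _ =>
          mem_iInf_of_mem i ((hball i x).mem_of_mem hr)
      refine mem_of_superset this fun y hy => hts (h y y.2 fun i hi => ?_)
      simp only [mem_iInter, Finset.mem_range] at hy
      exact hy i hi
    · refine le_iInf fun n => ?_
      refine (hball n x).ge_iff.2 fun ε hε => ?_
      have hc : Continuous fun y : A => q n ((y : E) - x) :=
        (hq.continuous n).comp (continuous_subtype_val.sub continuous_const)
      exact hc.continuousAt.eventually_lt continuousAt_const (by simpa using hε)
  let U : UniformSpace A := (⨅ n, u n).replaceTopology htop.symm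
  have hU : @uniformity A U = ⨅ n, @uniformity A (u n) := iInf_uniformity
  have hcg : IsCountablyGenerated (@uniformity A U) := by
    rw [hU]
    have : ∀ n, (@uniformity A (u n)).IsCountablyGenerated := fun n =>
      @EMetric.instIsCountablyGeneratedUniformity A (d n).toPseudoEMetricSpace
    exact Filter.iInf.isCountablyGenerated _
  have hcomp : CompleteSpace A := by
    refine UniformSpace.complete_of_cauchySeq_tendsto fun v hv => ?_
    obtain ⟨x, hx, hlim⟩ := hq.complete (fun n => v n) (fun n => (v n).2) fun i ε hε => by
      have hv' : Tendsto (fun p : ℕ × ℕ => (v p.1, v p.2)) atTop (@uniformity A U) :=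
        cauchySeq_iff_tendsto.1 hv
      rw [hU] at hv'
      have := (tendsto_iInf.1 hv' i).eventually ((hbasis i).mem_of_mem hε)
      obtain ⟨N, hN⟩ := eventually_atTop.1 this
      exact ⟨max N.1 N.2, fun m hm n hn =>
        hN (m, n) ⟨(le_max_left _ _).trans hm, (le_max_right _ _).trans hn⟩⟩
    exact ⟨⟨x, hx⟩, tendsto_subtype_rng.2 hlim⟩
  have hT : T0Space A := by
    refine ⟨fun x y hxy => Subtype.ext (hq.separating x x.2 y y.2 fun n => ?_)⟩
    have hc : Continuous fun z : A => q n ((z : E) - y) :=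
      (hq.continuous n).comp (continuous_subtype_val.sub continuous_const)
    simpa using (hxy.map hc).eq
  exact TopologicalSpace.IsCompletelyMetrizableSpace.of_completeSpace_metrizable

theorem IsBoundedConvexPolish.polishSpace [IsTopologicalAddGroup E] {A : Set E}
    (hA : IsBoundedConvexPolish A) : PolishSpace A := by
  obtain ⟨q, hq⟩ := hA.metrizable
  have := hq.isCompletelyMetrizableSpace
  have := hA.separable
  infer_instance

end Metrization

section Dual

variable {E : Type*} [AddCommGroup E] [Module ℝ E] [TopologicalSpace E]

/-- Hahn–Banach: the value of a continuous seminorm at a point is attained by a continuous functional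
that the seminorm dominates. -/
theorem Seminorm.exists_dual_apply_eq [IsTopologicalAddGroup E] [ContinuousSMul ℝ E]
    [LocallyConvexSpace ℝ E] {p : Seminorm ℝ E} (hp : Continuous p) (x : E) :
    ∃ φ : E →L[ℝ] ℝ, φ x = p x ∧ ∀ y, |φ y| ≤ p y := by
  by_cases hx : x = 0
  · exact ⟨0, by simp [hx], fun y => by simp⟩
  let e := LinearEquiv.toSpanNonzeroSingleton ℝ E x hx
  have key : ∀ y : Submodule.span ℝ {x}, (p x • e.symm.toLinearMap) y ≤ p y := by
    intro y
    obtain ⟨c, rfl⟩ := e.surjective y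
    have : ((e c : Submodule.span ℝ {x}) : E) = c • x := rfl
    simp only [LinearMap.smul_apply, LinearEquiv.coe_coe, LinearEquiv.symm_apply_apply,
      smul_eq_mul, this, map_smul_eq_mul, Real.norm_eq_abs]
    rw [mul_comm]
    exact mul_le_mul_of_nonneg_right (le_abs_self c) (apply_nonneg p x)
  obtain ⟨g, hg, hgp⟩ :=
    Module.Dual.exists_continuous_extension_of_le_seminorm_real _ (p x • e.symm.toLinearMap) hp key
  refine ⟨g, ?_, hgp⟩
  have h1 := hg (e 1)
  have h2 : ((e 1 : Submodule.span ℝ {x}) : E) = x := one_smul ℝ x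
  simpa [h2] using h1

theorem Bornology.IsVonNBounded.exists_seminorm_le {A : Set E} (hA : Bornology.IsVonNBounded ℝ A)
    {p : Seminorm ℝ E} (hp : Continuous p) : ∃ C : ℝ, ∀ x ∈ A, p x ≤ C := by
  have hmem : {x | p x < 1} ∈ 𝓝 (0 : E) :=
    hp.continuousAt.eventually_lt continuousAt_const (by simp)
  obtain ⟨r, hr⟩ := (hA hmem).exists_pos
  refine ⟨r, fun x hx => ?_⟩
  obtain ⟨y, hy, rfl⟩ := hr.2 r (by simp [abs_of_pos hr.1]) hx
  simp only [map_smul_eq_mul, Real.norm_eq_abs, abs_of_pos hr.1]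
  have : p y < 1 := hy
  nlinarith [hr.1]

theorem Bornology.IsVonNBounded.exists_abs_dual_le {A : Set E} (hA : Bornology.IsVonNBounded ℝ A)
    (φ : E →L[ℝ] ℝ) : ∃ C : ℝ, ∀ x ∈ A, |φ x| ≤ C := by
  refine hA.exists_seminorm_le (p := φ.toLinearMap.toSeminorm) ?_
  exact continuous_abs.comp φ.continuous

theorem Bornology.IsVonNBounded.integrable_dual [MeasurableSpace E] [BorelSpace E]
    {A : Set E} (hA : Bornology.IsVonNBounded ℝ A)
    (φ : E →L[ℝ] ℝ) (μ : Measure A) [IsFiniteMeasure μ] : Integrable (fun a : A => φ a) μ := by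
  obtain ⟨C, hC⟩ := hA.exists_abs_dual_le φ
  have hc : Continuous fun a : A => φ a := by fun_prop
  exact Integrable.of_bound hc.measurable.aestronglyMeasurable C (ae_of_all _ fun a => hC a a.2)

end Dual

/-! ### Barycenters -/

section Barycenter

theorem MeasureTheory.SimpleFunc.integral_comp_eq_sum {α β : Type*} [MeasurableSpace α]
    (μ : Measure α) [IsFiniteMeasure μ] (s : SimpleFunc α β) (g : β → ℝ) :
    ∫ a, g (s a) ∂μ = ∑ c ∈ s.range, μ.real (s ⁻¹' {c}) * g c := by
  classical
  have h : ∀ a, g (s a) = ∑ c ∈ s.range, (s ⁻¹' {c}).indicator (fun _ => g c) a := by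
    intro a
    rw [Finset.sum_eq_single_of_mem (s a) (s.mem_range_self a)]
    · simp
    · intro c _ hc
      simp [hc.symm]
  simp_rw [h]
  rw [integral_finsetSum _ fun c _ => (integrable_const _).indicator (s.measurableSet_fiber c)]
  refine Finset.sum_congr rfl fun c _ => ?_
  rw [integral_indicator_const _ (s.measurableSet_fiber c), smul_eq_mul]

variable {E : Type*} [AddCommGroup E] [Module ℝ E] [TopologicalSpace E]
  [IsTopologicalAddGroup E] [ContinuousSMul ℝ E] [LocallyConvexSpace ℝ E]
  {A : Set E}

theorem IsCompleteMetrizing.ext_of_dual {q : ℕ → Seminorm ℝ E} (hq : IsCompleteMetrizing q A)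
    {x y : E} (hx : x ∈ A) (hy : y ∈ A) (h : ∀ φ : E →L[ℝ] ℝ, φ x = φ y) : x = y := by
  refine hq.separating x hx y hy fun n => ?_
  obtain ⟨φ, hφ, -⟩ := (q n).exists_dual_apply_eq (hq.continuous n) (x - y)
  rw [← hφ, map_sub, h, sub_self]

variable [MeasurableSpace E] [BorelSpace E]

/-- Every probability measure on `A` has a barycenter. It is the limit of the barycenters `z n` of the
images of `μ` under simple functions `s n : A → A` converging to the identity; Hahn–Banach shows
that `z n` is a Cauchy sequence, and completeness of `A` replaces completeness of `E`. A functional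
on `E` need not be bounded by the seminorms `q i`, but it is bounded and continuous on `A`, which is
enough to pass to the limit. -/
theorem IsBoundedConvexPolish.exists_barycenter (hA : IsBoundedConvexPolish A) (μ : Measure A)
    [IsProbabilityMeasure μ] : ∃ z : A, ∀ φ : E →L[ℝ] ℝ, ∫ a, φ a ∂μ = φ z := by
  have := hA.polishSpace
  obtain ⟨q, hq⟩ := hA.metrizable
  have hsm : StronglyMeasurable (id : A → A) := stronglyMeasurable_id
  let s : ℕ → SimpleFunc A A := hsm.approx
  have hs : ∀ a, Tendsto (fun n => s n a) atTop (𝓝 a) := hsm.tendsto_approx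
  let z : ℕ → E := fun n => ∑ c ∈ (s n).range, μ.real (s n ⁻¹' {c}) • (c : E)
  have hφz : ∀ (φ : E →L[ℝ] ℝ) n, φ (z n) = ∫ a, φ (s n a) ∂μ := fun φ n => by
    rw [(s n).integral_comp_eq_sum μ fun c => φ c]
    simp [z]
  have hzA : ∀ n, z n ∈ A := fun n => by
    refine hA.convex.sum_mem (fun _ _ => measureReal_nonneg) ?_ fun c _ => c.2
    simpa using ((s n).integral_comp_eq_sum μ fun _ => (1 : ℝ)).symm
  have hint : ∀ (φ : E →L[ℝ] ℝ) n, Integrable (fun a => φ (s n a)) μ := fun φ n => by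
    obtain ⟨C, hC⟩ := hA.bounded.exists_abs_dual_le φ
    have hc : Continuous fun a : A => φ a := by fun_prop
    exact Integrable.of_bound (hc.measurable.comp (s n).measurable).aestronglyMeasurable C
      (ae_of_all _ fun a => hC _ (s n a).2)
  -- the simple functions `s n` converge to the identity in mean, for each of the seminorms
  have hmeas : ∀ i n, Measurable fun a => q i ((s n a : E) - a) := fun i n => by
    have hc : Continuous fun p : A × A => q i ((p.1 : E) - p.2) := by
      have := hq.continuous i
      fun_prop
    exact hc.measurable.comp ((s n).measurable.prodMk measurable_id)
  have hbd : ∀ i, ∃ C, ∀ n a, ‖q i ((s n a : E) - a)‖ ≤ C := fun i => by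
    obtain ⟨C, hC⟩ := hA.bounded.exists_seminorm_le (hq.continuous i)
    refine ⟨C + C, fun n a => ?_⟩
    rw [Real.norm_of_nonneg (apply_nonneg _ _)]
    exact (map_sub_le_add (q i) _ _).trans (add_le_add (hC _ (s n a).2) (hC a a.2))
  have hqint : ∀ i n, Integrable (fun a => q i ((s n a : E) - a)) μ := fun i n => by
    obtain ⟨C, hC⟩ := hbd i
    exact Integrable.of_bound (hmeas i n).aestronglyMeasurable C (ae_of_all _ (hC n))
  have hmean : ∀ i, Tendsto (fun n => ∫ a, q i ((s n a : E) - a) ∂μ) atTop (𝓝 0) := fun i => by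
    obtain ⟨C, hC⟩ := hbd i
    have := tendsto_integral_of_dominated_convergence (μ := μ)
      (F := fun n a => q i ((s n a : E) - a)) (f := fun _ => (0 : ℝ)) (fun _ => C)
      (fun n => (hmeas i n).aestronglyMeasurable) (integrable_const _)
      (fun n => ae_of_all _ (hC n)) (ae_of_all _ fun a => ?_)
    · simpa using this
    · have hc : Continuous fun b : A => q i ((b : E) - a) := by
        have := hq.continuous i
        fun_prop
      simpa [Function.comp_def] using (hc.tendsto a).comp (hs a)
  obtain ⟨x, hx, hlim⟩ := hq.complete z hzA fun i ε hε => by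
    obtain ⟨N, hN⟩ := eventually_atTop.1 ((hmean i).eventually_lt_const (half_pos hε))
    refine ⟨N, fun m hm n hn => ?_⟩
    obtain ⟨φ, hφ, hφq⟩ := (q i).exists_dual_apply_eq (hq.continuous i) (z m - z n)
    calc q i (z m - z n) = ∫ a, (φ (s m a) - φ (s n a)) ∂μ := by
          rw [← hφ, map_sub, hφz, hφz, integral_sub (hint φ m) (hint φ n)]
      _ ≤ ∫ a, (q i ((s m a : E) - a) + q i ((s n a : E) - a)) ∂μ := by
          refine integral_mono ((hint φ m).sub (hint φ n)) ((hqint i m).add (hqint i n)) fun a => ?_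
          have h1 := (abs_le.1 (hφq ((s m a : E) - a))).2
          have h2 := (abs_le.1 (hφq ((s n a : E) - a))).1
          simp only [map_sub] at h1 h2
          simp only
          linarith
      _ = (∫ a, q i ((s m a : E) - a) ∂μ) + ∫ a, q i ((s n a : E) - a) ∂μ :=
          integral_add (hqint i m) (hqint i n)
      _ < ε := by linarith [hN m hm, hN n hn]
  refine ⟨⟨x, hx⟩, fun φ => ?_⟩
  obtain ⟨C, hC⟩ := hA.bounded.exists_abs_dual_le φ
  have h1 : Tendsto (fun n => ∫ a, φ (s n a) ∂μ) atTop (𝓝 (∫ a : A, φ a ∂μ)) := by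
    refine tendsto_integral_of_dominated_convergence (fun _ => C)
      (fun n => (hint φ n).aestronglyMeasurable) (integrable_const _)
      (fun n => ae_of_all _ fun a => hC _ (s n a).2) (ae_of_all _ fun a => ?_)
    have hc : Continuous fun a : A => φ a := by fun_prop
    exact (hc.tendsto a).comp (hs a)
  have h2 : Tendsto (fun n => ∫ a, φ (s n a) ∂μ) atTop (𝓝 (φ x)) := by
    simp_rw [← hφz]
    exact (φ.continuous.tendsto x).comp hlim
  exact tendsto_nhds_unique h1 h2

/-- The barycenter of the normalized restriction of `μ` to `P`; if `P` is a null set, this is an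
arbitrary point of `A`. -/
theorem IsBoundedConvexPolish.exists_barycenter_restrict (hA : IsBoundedConvexPolish A)
    (μ : Measure A) [IsProbabilityMeasure μ] (P : Set A) :
    ∃ z : A, ∀ φ : E →L[ℝ] ℝ, ∫ a in P, φ a ∂μ = μ.real P * φ z := by
  by_cases hP : μ P = 0
  · obtain ⟨z, -⟩ := hA.exists_barycenter μ
    exact ⟨z, fun φ => by simp [measureReal_def, hP, Measure.restrict_eq_zero.2 hP]⟩
  · have := ProbabilityTheory.cond_isProbabilityMeasure (μ := μ) (s := P) hP
    obtain ⟨z, hz⟩ := hA.exists_barycenter (ProbabilityTheory.cond μ P)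
    refine ⟨z, fun φ => ?_⟩
    have h0 : μ.real P ≠ 0 := (measureReal_ne_zero_iff).2 hP
    rw [← hz φ, ProbabilityTheory.cond, integral_smul_measure, smul_eq_mul, ENNReal.toReal_inv,
      ← measureReal_def, mul_inv_cancel_left₀ h0]

/-- A barycenter of a measure on `P` lies in every ball that contains `P`, for each continuous
seminorm. -/
theorem Seminorm.sub_le_of_setIntegral_dual {p : Seminorm ℝ E} (hp : Continuous p)
    (hA : Bornology.IsVonNBounded ℝ A) {μ : Measure A} [IsFiniteMeasure μ] {P : Set A}
    (hPm : MeasurableSet P) (hP : μ.real P ≠ 0) {z : A}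
    (hz : ∀ φ : E →L[ℝ] ℝ, ∫ a in P, φ a ∂μ = μ.real P * φ z) {x : E} {r : ℝ}
    (h : ∀ a ∈ P, p (a - x) ≤ r) : p (z - x) ≤ r := by
  obtain ⟨φ, hφ, hφp⟩ := p.exists_dual_apply_eq hp ((z : E) - x)
  have hpos : 0 < μ.real P := lt_of_le_of_ne measureReal_nonneg hP.symm
  have h1 : ∫ a in P, (φ a - φ x) ∂μ ≤ ∫ _ in P, r ∂μ := by
    refine setIntegral_mono_on ((hA.integrable_dual φ μ).integrableOn.sub (integrable_const _))
      (integrable_const _) hPm fun a ha => ?_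
    rw [← map_sub]
    exact (abs_le.1 (hφp _)).2.trans (h a ha)
  rw [integral_sub (hA.integrable_dual φ μ).integrableOn (integrable_const _), hz] at h1
  simp only [setIntegral_const, smul_eq_mul] at h1
  rw [← mul_sub, ← map_sub, hφ] at h1
  exact le_of_mul_le_mul_left h1 hpos

end Barycenter

/-! ### The convex hull as an infimum of integrals -/

section CoHull

theorem MeasureTheory.SimpleFunc.sum_setIntegral_fiber {α β : Type*} [MeasurableSpace α]
    {μ : Measure α} (s : SimpleFunc α β) {f : α → ℝ} (hf : Integrable f μ) :
    ∑ c ∈ s.range, ∫ a in s ⁻¹' {c}, f a ∂μ = ∫ a, f a ∂μ := by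
  rw [← integral_biUnion_finset _ (fun c _ => s.measurableSet_fiber c) _
    (fun c _ => hf.integrableOn)]
  · have : ⋃ c ∈ s.range, s ⁻¹' {c} = univ :=
      eq_univ_of_forall fun a => mem_biUnion (s.mem_range_self a) rfl
    rw [this, setIntegral_univ]
  · intro c _ d _ hcd
    exact Disjoint.preimage _ (by simpa using hcd)

/-- A countable cover of a space of finite measure yields a finite measurable partition, the fibers
of `k`, all but one of which are contained in members of the cover, while the exceptional one has
small measure. -/
theorem exists_simpleFunc_of_iUnion_eq_univ {α : Type*} [MeasurableSpace α] (μ : Measure α)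
    [IsFiniteMeasure μ] {V : ℕ → Set α} (hV : ∀ n, MeasurableSet (V n)) (hU : ⋃ n, V n = univ)
    {δ : ℝ} (hδ : 0 < δ) : ∃ (n : ℕ) (k : SimpleFunc α ℕ), (∀ i, i ≠ n → k ⁻¹' {i} ⊆ V i) ∧
      μ.real (k ⁻¹' {n}) < δ := by
  classical
  have hex : ∀ a, ∃ n, a ∈ V n := fun a => mem_iUnion.1 (hU ▸ mem_univ a)
  have hN : Measurable fun a => Nat.find (hex a) := measurable_find hex fun n => hV n
  have hmeas : ∀ n : ℕ, MeasurableSet {a | n ≤ Nat.find (hex a)} := fun n =>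
    hN measurableSet_Ici
  have hlim : Tendsto (fun n => μ {a | n ≤ Nat.find (hex a)}) atTop (𝓝 0) := by
    have := tendsto_measure_iInter_atTop (μ := μ)
      (s := fun n : ℕ => {a | n ≤ Nat.find (hex a)}) (fun n => (hmeas n).nullMeasurableSet)
      (fun m n hmn a ha => hmn.trans ha) ⟨0, measure_ne_top _ _⟩
    have he : ⋂ n : ℕ, {a | n ≤ Nat.find (hex a)} = ∅ :=
      eq_empty_of_forall_notMem fun a ha => by
        have : Nat.find (hex a) + 1 ≤ Nat.find (hex a) := mem_iInter.1 ha _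
        omega
    rwa [he, measure_empty] at this
  have hlim' := (ENNReal.tendsto_toReal ENNReal.zero_ne_top).comp hlim
  obtain ⟨n, hn⟩ := (hlim'.eventually_lt_const (by simpa using hδ)).exists
  -- the first member of the cover that contains the point, truncated at `n`
  let k : SimpleFunc α ℕ :=
    { toFun := fun a => min (Nat.find (hex a)) n
      measurableSet_fiber' := fun i => (hN.min measurable_const) (measurableSet_singleton i)
      finite_range' := (finite_Iic n).subset (range_subset_iff.2 fun a => mem_Iic.2 (min_le_right _ _)) }
  refine ⟨n, k, fun i hi a ha => ?_, ?_⟩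
  · have h1 : min (Nat.find (hex a)) n = i := ha
    have h2 : Nat.find (hex a) = i := by omega
    exact h2 ▸ Nat.find_spec (hex a)
  · convert! hn using 1
    have : k ⁻¹' {n} = {a | n ≤ Nat.find (hex a)} := by
      ext a
      change min (Nat.find (hex a)) n = n ↔ _
      simp
    rw [this]
    rfl

variable {E : Type*} [AddCommGroup E] [Module ℝ E] [TopologicalSpace E]
  [IsTopologicalAddGroup E] [ContinuousSMul ℝ E] [LocallyConvexSpace ℝ E]
  [MeasurableSpace E] [BorelSpace E] {A : Set E}

/-- Jensen's inequality without semicontinuity: `g` is only convex, but it is dominated by a bounded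
continuous function, which appears on the right-hand side instead of `g`. -/
theorem ConvexOn.le_integral_of_isBoundedConvexPolish (hA : IsBoundedConvexPolish A) {g : E → ℝ}
    (hg : ConvexOn ℝ A g) {f : A →ᵇ ℝ} (hgf : ∀ a : A, g a ≤ f a) (μ : Measure A)
    [IsProbabilityMeasure μ] {x : A} (hx : ∀ φ : E →L[ℝ] ℝ, ∫ a, φ a ∂μ = φ x) :
    g x ≤ ∫ a, f a ∂μ := by
  have := hA.polishSpace
  obtain ⟨q, hq⟩ := hA.metrizable
  have hfi : Integrable f μ := f.integrable μ
  suffices h : ∀ ε : ℝ, 0 < ε → g x ≤ ∫ a, f a ∂μ + (2 * ε + 2 * ‖f‖ * ε) by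
    have hlim : Tendsto (fun ε : ℝ => ∫ a, f a ∂μ + (2 * ε + 2 * ‖f‖ * ε)) (𝓝[>] 0)
        (𝓝 (∫ a, f a ∂μ)) := by
      have : Continuous fun ε : ℝ => ∫ a, f a ∂μ + (2 * ε + 2 * ‖f‖ * ε) := by fun_prop
      simpa using (this.tendsto 0).mono_left nhdsWithin_le_nhds
    exact ge_of_tendsto hlim (eventually_mem_nhdsWithin.mono fun ε hε => h ε hε)
  intro ε hε
  -- closed convex neighbourhoods on which `f` is almost constant
  have hV : ∀ a : A, ∃ (n : ℕ) (r : ℝ), 0 < r ∧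
      ∀ y : A, (∀ i < n, q i ((y : E) - a) ≤ r) → |f y - f a| ≤ ε := by
    intro a
    have hmem : {y : A | |f y - f a| ≤ ε} ∈ 𝓝 a := by
      have hc : Continuous fun y : A => |f y - f a| := by fun_prop
      exact (hc.continuousAt.eventually_lt continuousAt_const (by simpa using hε)).mono
        fun y hy => le_of_lt hy
    rw [nhds_subtype_eq_comap, mem_comap] at hmem
    obtain ⟨t, ht, hts⟩ := hmem
    obtain ⟨n, r, hr, h⟩ := hq.nhds_basis a a.2 t ht
    exact ⟨n, r / 2, half_pos hr, fun y hy =>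
      hts (h y y.2 fun i hi => (hy i hi).trans_lt (half_lt_self hr))⟩
  choose n r hr hV using hV
  let V : A → Set A := fun a => {y | ∀ i < n a, q i ((y : E) - a) ≤ r a}
  have hqc : ∀ i (a : A), Continuous fun y : A => q i ((y : E) - a) := fun i a => by
    have := hq.continuous i
    fun_prop
  have hVm : ∀ a, MeasurableSet (V a) := fun a => by
    have : V a = ⋂ i, ⋂ (_ : i < n a), {y : A | q i ((y : E) - a) ≤ r a} := by
      ext y
      simp [V]
    rw [this]
    exact (isClosed_iInter fun i => isClosed_iInter fun _ =>
      isClosed_le (hqc i a) continuous_const).measurableSet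
  have hVn : ∀ a, V a ∈ 𝓝 a := fun a => by
    have : ∀ᶠ y : A in 𝓝 a, ∀ i ∈ Finset.range (n a), q i ((y : E) - a) < r a :=
      (Filter.eventually_all_finset _).2 fun i _ =>
        (hqc i a).continuousAt.eventually_lt continuousAt_const (by simpa using hr a)
    exact this.mono fun y hy i hi => (hy i (Finset.mem_range.2 hi)).le
  obtain ⟨c, hc⟩ : ∃ c : ℕ → A, ⋃ i, V (c i) = univ := by
    obtain ⟨s, hs, hsU⟩ := TopologicalSpace.countable_cover_nhds hVn
    have hsne : s.Nonempty := by
      by_contra h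
      rw [not_nonempty_iff_eq_empty] at h
      simp only [h, mem_empty_iff_false, iUnion_false, iUnion_empty] at hsU
      exact (hsU ▸ mem_univ x : x ∈ (∅ : Set A))
    obtain ⟨c, rfl⟩ := hs.exists_eq_range hsne
    exact ⟨c, by simpa using hsU⟩
  obtain ⟨N, k, hk, hkN⟩ := exists_simpleFunc_of_iUnion_eq_univ μ (fun i => hVm (c i)) hc hε
  choose z hz using fun i => hA.exists_barycenter_restrict μ (k ⁻¹' {i})
  have hw1 : ∑ i ∈ k.range, μ.real (k ⁻¹' {i}) = 1 := by
    simpa using (k.integral_comp_eq_sum μ fun _ => (1 : ℝ)).symm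
  have hxz : (x : E) = ∑ i ∈ k.range, μ.real (k ⁻¹' {i}) • (z i : E) := by
    refine hq.ext_of_dual x.2
      (hA.convex.sum_mem (fun _ _ => measureReal_nonneg) hw1 fun i _ => (z i).2) fun φ => ?_
    rw [← hx φ, ← k.sum_setIntegral_fiber (hA.bounded.integrable_dual φ μ)]
    simp [hz]
  -- on a non-null fiber of `i ≠ N`, `f (z i)` is within `2 * ε` of all values of `f`, as the fiber and
  -- `z i` lie in `V (c i)`; on that of `N` the trivial bound `|f| ≤ ‖f‖` is enough
  have hpiece : ∀ i, μ.real (k ⁻¹' {i}) * f (z i) ≤ ∫ a in k ⁻¹' {i}, f a ∂μ +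
      (2 * ε * μ.real (k ⁻¹' {i}) + if i = N then 2 * ‖f‖ * ε else 0) := by
    intro i
    have hw : 0 ≤ μ.real (k ⁻¹' {i}) := measureReal_nonneg
    by_cases hiN : i = N
    · subst hiN
      have h1 : -‖f‖ * μ.real (k ⁻¹' {i}) ≤ ∫ a in k ⁻¹' {i}, f a ∂μ := by
        have := setIntegral_mono_on (μ := μ) (s := k ⁻¹' {i}) (f := fun _ => -‖f‖) (g := f)
          (integrable_const _) hfi.integrableOn (k.measurableSet_fiber i)
          fun a _ => f.neg_norm_le_apply a
        simpa [mul_comm] using this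
      have h2 : f (z i) ≤ ‖f‖ := f.apply_le_norm _
      simp only [if_true]
      nlinarith [norm_nonneg f]
    · by_cases hw0 : μ.real (k ⁻¹' {i}) = 0
      · have : μ (k ⁻¹' {i}) = 0 := (measureReal_eq_zero_iff).1 hw0
        simp [hw0, hiN, Measure.restrict_eq_zero.2 this]
      · have hzV : z i ∈ V (c i) := fun j hj =>
          Seminorm.sub_le_of_setIntegral_dual (hq.continuous j) hA.bounded
            (k.measurableSet_fiber i) hw0 (hz i) fun a ha => hk i hiN ha j hj
        have h1 := setIntegral_mono_on (μ := μ) (s := k ⁻¹' {i}) (f := fun _ => f (z i) - 2 * ε)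
          (g := f) (integrable_const _) hfi.integrableOn (k.measurableSet_fiber i) fun a ha => by
            have h1 := abs_le.1 (hV (c i) a (hk i hiN ha))
            have h2 := abs_le.1 (hV (c i) (z i) hzV)
            linarith [h1.1, h2.2]
        simp only [setIntegral_const, smul_eq_mul] at h1
        simp only [hiN, if_false]
        linarith
  calc g x = g (∑ i ∈ k.range, μ.real (k ⁻¹' {i}) • (z i : E)) := by rw [← hxz]
    _ ≤ ∑ i ∈ k.range, μ.real (k ⁻¹' {i}) • g (z i) :=
        hg.map_sum_le (fun _ _ => measureReal_nonneg) hw1 fun i _ => (z i).2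
    _ ≤ ∑ i ∈ k.range, (∫ a in k ⁻¹' {i}, f a ∂μ +
          (2 * ε * μ.real (k ⁻¹' {i}) + if i = N then 2 * ‖f‖ * ε else 0)) :=
        Finset.sum_le_sum fun i _ =>
          (mul_le_mul_of_nonneg_left (hgf (z i)) measureReal_nonneg).trans (hpiece i)
    _ ≤ ∫ a, f a ∂μ + (2 * ε + 2 * ‖f‖ * ε) := by
        rw [Finset.sum_add_distrib, Finset.sum_add_distrib, k.sum_setIntegral_fiber hfi,
          ← Finset.mul_sum, hw1, Finset.sum_ite_eq']
        have : 0 ≤ 2 * ‖f‖ * ε := by positivity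
        split_ifs <;> linarith

/-- The convex hull of `f` at `x` is the infimum of the integrals of `f` over the measures with
barycenter `x`. -/
theorem isGLB_coHull (hA : IsBoundedConvexPolish A) (f : A →ᵇ ℝ) (x : A) :
    IsGLB {r | ∃ μ : ProbabilityMeasure A, IsBarycenter μ x ∧ ∫ a, f a ∂(μ : Measure A) = r}
      (coHull f x) := by
  classical
  obtain ⟨⟨⟨g, hg, hgh⟩, hle⟩, hmax⟩ := isGreatest_coHull hA.convex f
  refine ⟨?_, fun c hc => ?_⟩
  · rintro r ⟨μ, hμ, rfl⟩
    rw [← hgh x]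
    exact hg.le_integral_of_isBoundedConvexPolish hA (fun a => (hgh a).trans_le (hle a)) μ
      fun φ => (hμ φ).2
  let S : A → Set ℝ := fun y =>
    {r | ∃ μ : ProbabilityMeasure A, IsBarycenter μ y ∧ ∫ a, f a ∂(μ : Measure A) = r}
  have hbdd : ∀ y, BddBelow (S y) := fun y => by
    refine ⟨-‖f‖, ?_⟩
    rintro r ⟨μ, -, rfl⟩
    have := integral_mono (μ := (μ : Measure A)) (integrable_const (-‖f‖)) (f.integrable _)
      fun a => f.neg_norm_le_apply a
    simpa using this
  have hdirac : ∀ y, f y ∈ S y := fun y => by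
    refine ⟨⟨Measure.dirac y, inferInstance⟩, fun φ => ⟨?_, ?_⟩, ?_⟩
    · exact hA.bounded.integrable_dual φ (Measure.dirac y)
    · have hc : Continuous fun a : A => φ a := by fun_prop
      exact integral_dirac' _ _ hc.measurable.stronglyMeasurable
    · exact integral_dirac' _ _ f.continuous.measurable.stronglyMeasurable
  -- a convex combination of measures has the corresponding combination of barycenters
  have hconv : ConvexOn ℝ A fun y => if hy : y ∈ A then sInf (S ⟨y, hy⟩) else 0 := by
    refine ⟨hA.convex, fun y hy w hw a b ha hb hab => ?_⟩
    have hyw := hA.convex hy hw ha hb hab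
    simp only [hy, hw, hyw, dite_true, smul_eq_mul]
    refine le_of_forall_pos_le_add fun ε hε => ?_
    obtain ⟨_, ⟨μ, hμ, rfl⟩, hμε⟩ :=
      exists_lt_of_csInf_lt ⟨_, hdirac ⟨y, hy⟩⟩ (lt_add_of_pos_right (sInf (S ⟨y, hy⟩)) hε)
    obtain ⟨_, ⟨ν, hν, rfl⟩, hνε⟩ :=
      exists_lt_of_csInf_lt ⟨_, hdirac ⟨w, hw⟩⟩ (lt_add_of_pos_right (sInf (S ⟨w, hw⟩)) hε)
    have hint : ∀ h : A → ℝ, Integrable h (μ : Measure A) → Integrable h (ν : Measure A) →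
        ∫ t, h t ∂(ENNReal.ofReal a • (μ : Measure A) + ENNReal.ofReal b • (ν : Measure A)) =
          a * ∫ t, h t ∂(μ : Measure A) + b * ∫ t, h t ∂(ν : Measure A) := fun h h1 h2 => by
      rw [integral_add_measure (h1.smul_measure ENNReal.ofReal_ne_top)
        (h2.smul_measure ENNReal.ofReal_ne_top), integral_smul_measure, integral_smul_measure,
        ENNReal.toReal_ofReal ha, ENNReal.toReal_ofReal hb, smul_eq_mul, smul_eq_mul]
    have hprob : IsProbabilityMeasure
        (ENNReal.ofReal a • (μ : Measure A) + ENNReal.ofReal b • (ν : Measure A)) := by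
      constructor
      simp [← ENNReal.ofReal_add ha hb, hab]
    have hmem : a * ∫ t, f t ∂(μ : Measure A) + b * ∫ t, f t ∂(ν : Measure A) ∈
        S ⟨a • y + b • w, hyw⟩ := by
      refine ⟨⟨_, hprob⟩, fun φ => ⟨(hA.bounded.integrable_dual φ (ENNReal.ofReal a • (μ : Measure A) +
          ENNReal.ofReal b • (ν : Measure A)) :), ?_⟩,
        hint f (f.integrable _) (f.integrable _)⟩
      refine (hint (fun t => φ t) (hμ φ).1 (hν φ).1).trans ?_
      rw [(hμ φ).2, (hν φ).2]
      simp
    refine (csInf_le (hbdd _) hmem).trans ?_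
    nlinarith
  have key := hmax (a := fun y => sInf (S y))
    ⟨⟨_, hconv, fun a => by simp⟩, fun y => csInf_le (hbdd y) (hdirac y)⟩ x
  exact (le_csInf ⟨_, hdirac x⟩ fun r hr => hc hr).trans key

end CoHull

/-! ### A criterion for tightness -/

section Tightness

/-- The tent functions `max 0 (1 - infDist · F / δ)` of an increasing sequence of finite subsets `F`
of a dense set increase to `1`, and each of them is supported near a finite set. So uniform
convergence of their integrals provides the finite sets of small balls of almost full measure from
which a compact set is built. -/
theorem isTightMeasureSet_of_forall_integral_ge {X : Type*} [TopologicalSpace X] [PolishSpace X]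
    [MeasurableSpace X] [BorelSpace X] {S : Set (ProbabilityMeasure X)}
    (H : ∀ f : ℕ → X →ᵇ ℝ, (∀ x, Monotone fun n => f n x) →
      (∀ x, Tendsto (fun n => f n x) atTop (𝓝 1)) →
      ∀ ε : ℝ, 0 < ε → ∃ n, ∀ μ ∈ S, 1 - ε ≤ ∫ x, f n x ∂(μ : Measure X)) :
    IsTightMeasureSet {((μ : ProbabilityMeasure X) : Measure X) | μ ∈ S} := by
  let := TopologicalSpace.upgradeIsCompletelyMetrizable X
  rw [isTightMeasureSet_iff_exists_isCompact_measure_compl_le]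
  intro ε hε
  rcases isEmpty_or_nonempty X with hX | hX
  · exact ⟨∅, isCompact_empty, fun μ _ => by simp [Measure.eq_zero_of_isEmpty μ]⟩
  obtain ⟨D, hD⟩ := TopologicalSpace.exists_dense_seq X
  let F : ℕ → Set X := fun n => D '' Iic n
  have hFne : ∀ n, (F n).Nonempty := fun n => ⟨D 0, 0, Nat.zero_le n, rfl⟩
  have hFmono : ∀ {m n}, m ≤ n → F m ⊆ F n := fun h => image_mono (Iic_subset_Iic.2 h)
  have key : ∀ δ : ℝ, 0 < δ → ∀ η : ENNReal, 0 < η → ∃ n, ∀ μ ∈ S,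
      (μ : Measure X) {x | δ ≤ Metric.infDist x (F n)} ≤ η := by
    intro δ hδ η hη
    obtain ⟨η', hη', hle⟩ : ∃ η' : ℝ, 0 < η' ∧ ENNReal.ofReal η' ≤ η := by
      rcases eq_or_ne η ⊤ with rfl | h
      · exact ⟨1, one_pos, le_top⟩
      · exact ⟨η.toReal, ENNReal.toReal_pos hη.ne' h, (ENNReal.ofReal_toReal h).le⟩
    let f : ℕ → X →ᵇ ℝ := fun n => BoundedContinuousFunction.ofNormedAddCommGroup
      (fun x => max 0 (1 - Metric.infDist x (F n) / δ))
      (by have := Metric.continuous_infDist_pt (F n); fun_prop) 1 fun x => by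
        have : 0 ≤ Metric.infDist x (F n) / δ := div_nonneg Metric.infDist_nonneg hδ.le
        rw [Real.norm_of_nonneg (le_max_left _ _)]
        exact max_le zero_le_one (by linarith)
    have hfmono : ∀ x, Monotone fun n => f n x := by
      intro x m n hmn
      have : Metric.infDist x (F n) ≤ Metric.infDist x (F m) :=
        Metric.infDist_le_infDist_of_subset (hFmono hmn) (hFne m)
      change max 0 (1 - Metric.infDist x (F m) / δ) ≤ max 0 (1 - Metric.infDist x (F n) / δ)
      gcongr
    have hflim : ∀ x, Tendsto (fun n => f n x) atTop (𝓝 1) := by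
      intro x
      have hlim : Tendsto (fun n => Metric.infDist x (F n)) atTop (𝓝 0) := by
        refine Metric.tendsto_atTop.2 fun r hr => ?_
        obtain ⟨i, hi⟩ := Metric.denseRange_iff.1 hD x r hr
        refine ⟨i, fun n hn => ?_⟩
        rw [Real.dist_0_eq_abs, abs_of_nonneg Metric.infDist_nonneg]
        exact (Metric.infDist_le_dist_of_mem (mem_image_of_mem D (mem_Iic.2 hn))).trans_lt hi
      have := (tendsto_const_nhds (x := (0 : ℝ))).max
        ((tendsto_const_nhds (x := (1 : ℝ))).sub (hlim.div_const δ))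
      simpa [f] using this
    obtain ⟨n, hn⟩ := H f hfmono hflim η' hη'
    refine ⟨n, fun μ hμ => ?_⟩
    have hm : MeasurableSet {x | δ ≤ Metric.infDist x (F n)} :=
      (isClosed_le continuous_const (Metric.continuous_infDist_pt _)).measurableSet
    have h1 : ∫ x, f n x ∂(μ : Measure X) ≤
        ∫ x, {x | δ ≤ Metric.infDist x (F n)}ᶜ.indicator (fun _ => (1 : ℝ)) x ∂(μ : Measure X) := by
      refine integral_mono ((f n).integrable _) ((integrable_const _).indicator hm.compl)
        fun x => ?_
      by_cases hx : δ ≤ Metric.infDist x (F n)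
      · have : 1 - Metric.infDist x (F n) / δ ≤ 0 := by
          rw [sub_nonpos, one_le_div hδ]
          exact hx
        simpa [f, hx] using this
      · have : 0 ≤ Metric.infDist x (F n) / δ := div_nonneg Metric.infDist_nonneg hδ.le
        simpa [f, hx] using this
    rw [integral_indicator_const _ hm.compl, smul_eq_mul, mul_one,
      probReal_compl_eq_one_sub hm] at h1
    refine le_trans ?_ hle
    rw [← ofReal_measureReal]
    exact ENNReal.ofReal_le_ofReal (by linarith [hn μ hμ])
  obtain ⟨η, hη, hηsum⟩ := ENNReal.exists_pos_sum_of_countable' hε.ne' ℕ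
  have hδ : ∀ m : ℕ, (0 : ℝ) < 1 / (m + 1) := fun m => Nat.one_div_pos_of_nat
  choose n hn using fun m : ℕ => key (1 / (m + 1)) (hδ m) (η m) (hη m)
  let K : Set X := ⋂ m : ℕ, {x | Metric.infDist x (F (n m)) ≤ 1 / ((m : ℝ) + 1)}
  have hKc : IsClosed K := isClosed_iInter fun m =>
    isClosed_le (Metric.continuous_infDist_pt _) continuous_const
  refine ⟨K, TotallyBounded.isCompact_of_isClosed ?_ hKc, ?_⟩
  · refine Metric.totallyBounded_iff.2 fun r hr => ?_
    obtain ⟨m, hm⟩ := exists_nat_one_div_lt hr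
    refine ⟨F (n m), (finite_Iic _).image _, fun x hx => ?_⟩
    have hxm : Metric.infDist x (F (n m)) < r := (mem_iInter.1 hx m).trans_lt hm
    obtain ⟨y, hy, hxy⟩ := (Metric.infDist_lt_iff (hFne _)).1 hxm
    exact mem_biUnion hy hxy
  · rintro _ ⟨μ, hμ, rfl⟩
    calc (μ : Measure X) Kᶜ
        ≤ (μ : Measure X) (⋃ m : ℕ, {x | 1 / ((m : ℝ) + 1) ≤ Metric.infDist x (F (n m))}) := by
          refine measure_mono fun x hx => ?_
          simp only [K, mem_compl_iff, mem_iInter, mem_ofPred_eq, not_forall, not_le] at hx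
          obtain ⟨m, hm⟩ := hx
          exact mem_iUnion.2 ⟨m, hm.le⟩
      _ ≤ ∑' m : ℕ, (μ : Measure X) {x | 1 / ((m : ℝ) + 1) ≤ Metric.infDist x (F (n m))} :=
          measure_iUnion_le _
      _ ≤ ∑' m, η m := ENNReal.tsum_le_tsum fun m => hn m μ hμ
      _ ≤ ε := hηsum.le

end Tightness

/-! ### Compactness of preimages under the barycenter map -/

section Main

/-- The part of Dini's theorem that uses only lower semicontinuity. -/
theorem IsCompact.exists_forall_lt_of_monotone {X : Type*} [TopologicalSpace X] {K : Set X}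
    (hK : IsCompact K) {F : ℕ → X → ℝ} (hF : ∀ n, LowerSemicontinuous (F n))
    (hmono : ∀ x, Monotone fun n => F n x) {c : ℝ} (hc : ∀ x ∈ K, ∃ n, c < F n x) :
    ∃ n, ∀ x ∈ K, c < F n x :=
  hK.elim_directed_cover (fun n => {x | c < F n x}) (fun n => (hF n).isOpen_preimage c)
    (fun x hx => mem_iUnion.2 (hc x hx))
    (directed_of_isDirected_le fun _ _ hmn x hx => lt_of_lt_of_le hx (hmono x hmn))

theorem MeasureTheory.ProbabilityMeasure.continuous_integral {X : Type*} [TopologicalSpace X]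
    [MeasurableSpace X] [OpensMeasurableSpace X] (f : X →ᵇ ℝ) :
    Continuous fun μ : ProbabilityMeasure X => ∫ x, f x ∂(μ : Measure X) :=
  continuous_iff_continuousAt.2 fun _ =>
    ProbabilityMeasure.tendsto_iff_forall_integral_tendsto.1 tendsto_id f

theorem lowerSemicontinuousOn_iff_comp_val {X : Type*} [TopologicalSpace X] {s : Set X}
    {g : X → ℝ} : LowerSemicontinuousOn g s ↔ LowerSemicontinuous fun x : s => g x := by
  refine Iff.trans (b := ∀ x : s, LowerSemicontinuousWithinAt g s x) ?_ (forall_congr' fun x => ?_)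
  · rw [lowerSemicontinuousOn_iff, Subtype.forall]
  · simp only [lowerSemicontinuousWithinAt_iff, lowerSemicontinuousAt_iff,
      nhdsWithin_eq_map_subtype_coe x.2, eventually_map]

variable {E : Type*} [AddCommGroup E] [Module ℝ E] [TopologicalSpace E]

theorem coHull_le {A : Set E} (hA : Convex ℝ A) (f : A →ᵇ ℝ) (x : A) : coHull f x ≤ f x :=
  (isGreatest_coHull hA f).1.2 x

theorem coHull_mono {A : Set E} (hA : Convex ℝ A) {f g : A →ᵇ ℝ} (h : ∀ x, f x ≤ g x) (x : A) :
    coHull f x ≤ coHull g x :=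
  (isGreatest_coHull hA g).2
    ⟨(isGreatest_coHull hA f).1.1, fun y => (coHull_le hA f y).trans (h y)⟩ x

theorem coHull_one {A : Set E} (hA : Convex ℝ A) (x : A) :
    coHull (BoundedContinuousFunction.const A (1 : ℝ)) x = 1 :=
  le_antisymm (coHull_le hA _ x) ((isGreatest_coHull hA (BoundedContinuousFunction.const A 1)).2
    ⟨⟨fun _ => 1, convexOn_const _ hA, fun _ => rfl⟩, fun _ => le_rfl⟩ x)

theorem coClosure_le_coHull {A : Set E} (hA : Convex ℝ A) (f : A →ᵇ ℝ) (x : A) :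
    coClosure f x ≤ coHull f x := by
  obtain ⟨⟨⟨g, hg, -, hgf⟩, hle⟩, -⟩ := isGreatest_coClosure hA f
  exact (isGreatest_coHull hA f).2 ⟨⟨g, hg, hgf⟩, hle⟩ x

theorem coHull_eq_coClosure_iff {A : Set E} (hA : Convex ℝ A) (f : A →ᵇ ℝ) :
    (∀ x : A, coHull f x = coClosure f x) ↔ LowerSemicontinuous (coHull f : A → ℝ) := by
  constructor
  · intro h
    obtain ⟨⟨⟨g, -, hg, hgf⟩, -⟩, -⟩ := isGreatest_coClosure hA f
    have hr : (fun a : A => g a) = coHull f := funext fun a => (hgf a).trans (h a).symm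
    exact hr ▸ lowerSemicontinuousOn_iff_comp_val.1 hg
  · intro h x
    obtain ⟨⟨⟨g, hg, hgf⟩, hle⟩, -⟩ := isGreatest_coHull hA f
    have hr : (fun a : A => g a) = coHull f := funext hgf
    refine le_antisymm ((isGreatest_coClosure hA f).2 ⟨⟨g, hg, ?_, hgf⟩, hle⟩ x)
      (coClosure_le_coHull hA f x)
    exact lowerSemicontinuousOn_iff_comp_val.2 (hr ▸ h)

variable [MeasurableSpace E] [BorelSpace E] {A : Set E}

theorem Bornology.IsVonNBounded.continuous_integral_dual (hA : Bornology.IsVonNBounded ℝ A)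
    (φ : E →L[ℝ] ℝ) :
    Continuous fun μ : ProbabilityMeasure A => ∫ a : A, φ a ∂(μ : Measure A) := by
  obtain ⟨C, hC⟩ := hA.exists_abs_dual_le φ
  exact ProbabilityMeasure.continuous_integral
    (BoundedContinuousFunction.ofNormedAddCommGroup (fun a : A => φ a) (by fun_prop) C
      fun a => hC a a.2)

theorem isClosed_setOf_isBarycenter (hA : Bornology.IsVonNBounded ℝ A) :
    IsClosed {p : ProbabilityMeasure A × A | IsBarycenter p.1 p.2} := by
  have : {p : ProbabilityMeasure A × A | IsBarycenter p.1 p.2} =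
      ⋂ φ : E →L[ℝ] ℝ, {p | ∫ a : A, φ a ∂(p.1 : Measure A) = φ p.2} := by
    ext p
    simp only [mem_iInter, mem_ofPred_eq]
    exact ⟨fun h φ => (h φ).2, fun h φ => ⟨hA.integrable_dual φ _, h φ⟩⟩
  rw [this]
  exact isClosed_iInter fun φ => isClosed_eq
    ((hA.continuous_integral_dual φ).comp continuous_fst) (by fun_prop)

theorem isClosed_preimage_barycenter (hA : Bornology.IsVonNBounded ℝ A) {K : Set A}
    (hK : IsCompact K) : IsClosed {μ : ProbabilityMeasure A | ∃ x ∈ K, IsBarycenter μ x} := by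
  have : CompactSpace K := isCompact_iff_compactSpace.1 hK
  have hcl : IsClosed {p : ProbabilityMeasure A × K | IsBarycenter p.1 (p.2 : A)} :=
    (isClosed_setOf_isBarycenter hA).preimage
      (continuous_fst.prodMk (continuous_subtype_val.comp continuous_snd))
  convert! isClosedMap_fst_of_compactSpace _ hcl using 1
  ext μ
  simp

theorem IsMuCompact.isPointwiseMuCompact (h : IsMuCompact A) : IsPointwiseMuCompact A :=
  fun x => by simpa using h {x} isCompact_singleton

variable [IsTopologicalAddGroup E] [ContinuousSMul ℝ E] [LocallyConvexSpace ℝ E]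

theorem coHull_le_integral (hA : IsBoundedConvexPolish A) (f : A →ᵇ ℝ) {x : A}
    {μ : ProbabilityMeasure A} (hμ : IsBarycenter μ x) :
    coHull f x ≤ ∫ a, f a ∂(μ : Measure A) :=
  (isGLB_coHull hA f x).1 ⟨μ, hμ, rfl⟩

/-- The preimage under the barycenter map of a compact set `K` is compact as soon as, for bounded
continuous functions increasing to `1`, the convex hulls converge to `1` uniformly on `K`. -/
theorem isCompact_preimage_barycenter (hA : IsBoundedConvexPolish A) {K : Set A}
    (hK : IsCompact K) (H : ∀ f : ℕ → A →ᵇ ℝ, (∀ x, Monotone fun n => f n x) →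
      (∀ x, Tendsto (fun n => f n x) atTop (𝓝 1)) →
      ∀ c : ℝ, c < 1 → ∃ n, ∀ x ∈ K, c < coHull (f n) x) :
    IsCompact {μ : ProbabilityMeasure A | ∃ x ∈ K, IsBarycenter μ x} := by
  have := hA.polishSpace
  rw [← (isClosed_preimage_barycenter hA.bounded hK).closure_eq]
  refine isCompact_closure_of_isTightMeasureSet (isTightMeasureSet_of_forall_integral_ge ?_)
  intro f hmono hlim ε hε
  obtain ⟨n, hn⟩ := H f hmono hlim (1 - ε) (by linarith)
  refine ⟨n, ?_⟩
  rintro μ ⟨x, hx, hμ⟩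
  exact (hn x hx).le.trans (coHull_le_integral hA (f n) hμ)

theorem IsPointwiseMuCompact.tendsto_coHull (hA : IsBoundedConvexPolish A)
    (hpt : IsPointwiseMuCompact A) {f : ℕ → A →ᵇ ℝ} {f₀ : A →ᵇ ℝ}
    (hmono : ∀ x, Monotone fun n => f n x)
    (hlim : ∀ x, Tendsto (fun n => f n x) atTop (𝓝 (f₀ x))) (x : A) :
    Tendsto (fun n => coHull (f n) x) atTop (𝓝 (coHull f₀ x)) := by
  have hle : ∀ n y, f n y ≤ f₀ y := fun n y => (hmono y).ge_of_tendsto (hlim y) n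
  have hcomono : Monotone fun n => coHull (f n) x := fun m n hmn =>
    coHull_mono hA.convex (fun y => hmono y hmn) x
  refine tendsto_order.2 ⟨fun c hc => ?_, fun c hc => Eventually.of_forall fun n =>
    (coHull_mono hA.convex (hle n) x).trans_lt hc⟩
  obtain ⟨d, hcd, hd⟩ := exists_between hc
  obtain ⟨n, hn⟩ := (hpt x).exists_forall_lt_of_monotone (c := d)
    (F := fun n (μ : ProbabilityMeasure A) => ∫ a, f n a ∂(μ : Measure A))
    (fun n => (ProbabilityMeasure.continuous_integral (f n)).lowerSemicontinuous)
    (fun μ m n hmn => integral_mono ((f m).integrable _) ((f n).integrable _)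
      fun a => hmono a hmn)
    (fun μ hμ => by
      have := integral_tendsto_of_tendsto_of_monotone (μ := (μ : Measure A))
        (fun n => (f n).integrable _) (f₀.integrable _) (ae_of_all _ hmono) (ae_of_all _ hlim)
      exact (this.eventually_const_lt (hd.trans_le (coHull_le_integral hA f₀ hμ))).exists)
  filter_upwards [eventually_ge_atTop n] with m hm
  refine hcd.trans_le (le_trans ?_ (hcomono hm))
  refine (isGLB_coHull hA (f n) x).2 ?_
  rintro r ⟨μ, hμ, rfl⟩
  exact (hn μ hμ).le

/-- Nearly optimal measures for the points of a convergent sequence have a cluster point, because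
the sequence and its limit form a compact set. -/
theorem IsMuCompact.lowerSemicontinuous_coHull (hA : IsBoundedConvexPolish A) (h : IsMuCompact A)
    (f : A →ᵇ ℝ) : LowerSemicontinuous (coHull f : A → ℝ) := by
  have := hA.polishSpace
  intro x c hc
  by_contra hcon
  obtain ⟨u, hu, huc⟩ := exists_seq_forall_of_frequently (not_eventually.1 hcon)
  obtain ⟨d, hcd, hd⟩ := exists_between hc
  have hμ : ∀ n, ∃ μ : ProbabilityMeasure A, IsBarycenter μ (u n) ∧
      ∫ a, f a ∂(μ : Measure A) < d := fun n => by
    obtain ⟨_, ⟨μ, hμ, rfl⟩, hlt⟩ :=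
      (isGLB_lt_iff (isGLB_coHull hA f (u n))).1 ((not_lt.1 (huc n)).trans_lt hcd)
    exact ⟨μ, hμ, hlt⟩
  choose μ hμb hμd using hμ
  obtain ⟨ν, -, hν⟩ := (h _ hu.isCompact_insert_range).exists_mapClusterPt (f := atTop) (u := μ)
    (tendsto_principal.2 (Eventually.of_forall fun n =>
      ⟨u n, mem_insert_of_mem _ (mem_range_self n), hμb n⟩))
  obtain ⟨U, hU, hUν⟩ := mapClusterPt_iff_ultrafilter.1 hν
  have hνx : IsBarycenter ν x :=
    (isClosed_setOf_isBarycenter hA.bounded).mem_of_tendsto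
      (hUν.prodMk_nhds (hu.mono_left hU)) (Eventually.of_forall hμb)
  have hνd : ∫ a, f a ∂(ν : Measure A) ≤ d :=
    le_of_tendsto (((ProbabilityMeasure.continuous_integral f).tendsto ν).comp hUν)
      (Eventually.of_forall fun n => (hμd n).le)
  exact (hd.trans_le (coHull_le_integral hA f hνx)).not_ge hνd

end Main

theorem mainTheorem3 {E : Type*} [AddCommGroup E] [Module ℝ E] [TopologicalSpace E]
    [IsTopologicalAddGroup E] [ContinuousSMul ℝ E] [LocallyConvexSpace ℝ E]
    [MeasurableSpace E] [BorelSpace E] (A : Set E) (hA : IsBoundedConvexPolish A) :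
    (IsPointwiseMuCompact A ↔
      ∀ (f : ℕ → (A →ᵇ ℝ)) (f₀ : A →ᵇ ℝ),
        (∀ x : A, Monotone fun n => f n x) →
        (∀ x : A, Tendsto (fun n => f n x) atTop (𝓝 (f₀ x))) →
        ∀ x : A, Tendsto (fun n => coHull (f n) x) atTop (𝓝 (coHull f₀ x))) ∧
    (IsMuCompact A ↔
      IsPointwiseMuCompact A ∧ ∀ (f : A →ᵇ ℝ) (x : A), coHull f x = coClosure f x) := by
  refine ⟨⟨fun h f f₀ hmono hlim x => h.tendsto_coHull hA hmono hlim x, fun h x => ?_⟩,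
    ⟨fun h => ⟨h.isPointwiseMuCompact, fun f =>
      (coHull_eq_coClosure_iff hA.convex f).2 (h.lowerSemicontinuous_coHull hA f)⟩, ?_⟩⟩
  -- apply the convergence to the limit function `1`, whose convex hull is `1`
  · have := isCompact_preimage_barycenter hA (isCompact_singleton (x := x))
      fun f hmono hlim c hc => by
        have hx := h f (BoundedContinuousFunction.const A 1) hmono hlim x
        rw [coHull_one hA.convex] at hx
        simpa using (hx.eventually_const_lt hc).exists
    simpa using this
  · rintro ⟨hpt, hco⟩ K hK
    refine isCompact_preimage_barycenter hA hK fun f hmono hlim c hc => ?_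
    refine hK.exists_forall_lt_of_monotone
      (fun n => (coHull_eq_coClosure_iff hA.convex (f n)).1 (hco (f n)))
      (fun x m n hmn => coHull_mono hA.convex (fun y => hmono y hmn) x) fun x _ => ?_
    have hx := hpt.tendsto_coHull hA (f₀ := BoundedContinuousFunction.const A 1) hmono hlim x
    rw [coHull_one hA.convex] at hx
    exact (hx.eventually_const_lt hc).exists
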